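/- \textbf{Corollary (Positivity).} Let $f$ be a function of the Ruijsenaars class, i.e. $f(t)$ is analytic for $\Re(t)>0$ and at $t=0$, and of at worst polynomial growth as $t\to+\infty$; assume moreover that $f(t)$ is real and $f(t)>0$ for all real $t\ge 0$. Let $M\ge 0$ be an integer. For $\Re(w)>0$ let $\zeta_M(s,w)$ denote the analytic continuation, in $s$, to $\mathbb{C}\setminus\{1,\dots,M\}$ of $$\zeta_M(s,w)=\frac{1}{\Gamma(s)}\int_0^\infty t^{s-1}e^{-wt}f(t)\,\frac{dt}{t^M},\qquad \Re(s)>M,$$ and let $L_M(w)=\partial_s\zeta_M(s,w)|_{s=0}$ be the corresponding generalized log-gamma function. Let $N\ge 0$ be an integer, let $b_0,b_1,\dots,b_N$ be positive real numbers, and put $$(\mathcal{S}_N L_M)(q\,|\,b)=\sum_{p=0}^N(-1)^p\sum_{1\le k_1<\cdots<k_p\le N}L_M\bigl(q+b_0+b_{k_1}+\cdots+b_{k_p}\bigr).$$ If $M<N$, then $(\mathcal{S}_N L_M)(0\,|\,b)$ is real and $$(\mathcal{S}_N L_M)(0\,|\,b)>0 .$$ (The main example is $f(t)=t^M\prod_{j=1}^M(1-e^{-a_jt})^{-1}$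 with $a_j>0$, for which $L_M(w)=L_M(w\,|\,a)$ is the Barnes multiple log-gamma function.) -/

import Mathlib

open Complex MeasureTheory Set Filter Asymptotics

noncomputable section

namespace RuijsenaarsGamma

/-- The Ruijsenaars class: `f` is analytic for `Re t > 0` and at `t = 0`, and of at worst
polynomial growth as `t → +∞`. -/
structure RuijsenaarsClass (f : ℂ → ℂ) : Prop where
  analytic_right : ∀ t : ℂ, 0 < t.re → AnalyticAt ℂ f t
  analytic_zero : AnalyticAt ℂ f 0
  growth : ∃ n : ℕ, (fun t : ℝ => f (t : ℂ)) =O[atTop] fun t : ℝ => t ^ n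

/-- The generalized zeta function `ζ_M(s, w)` in its domain `Re s > M`, `Re w > 0`:
`Γ(s)⁻¹ ∫₀^∞ t^(s-1) e^(-wt) f(t) dt / t^M`. -/
def zetaIntegral (f : ℂ → ℂ) (M : ℕ) (w s : ℂ) : ℂ :=
  1 / Complex.Gamma s *
    ∫ t in Ioi (0 : ℝ), (t : ℂ) ^ (s - 1) * Complex.exp (-w * t) * f t / (t : ℂ) ^ M

/-- The points `1, …, M`, where the continued zeta function may have its (simple) poles. -/
def zetaPoles (M : ℕ) : Set ℂ := {s | ∃ k : ℕ, 1 ≤ k ∧ k ≤ M ∧ s = (k : ℂ)}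

/-- `Z` is the analytic continuation of `s ↦ ζ_M(s, w)` from `Re s > M` to
`ℂ ∖ {1, …, M}`. -/
structure IsZetaContinuation (f : ℂ → ℂ) (M : ℕ) (w : ℂ) (Z : ℂ → ℂ) : Prop where
  analytic : AnalyticOnNhd ℂ Z (zetaPoles M)ᶜ
  eq_integral : ∀ s : ℂ, (M : ℝ) < s.re → Z s = zetaIntegral f M w s

/-- The continuation is unique away from `1, …, M`. -/
theorem IsZetaContinuation.eqOn {f : ℂ → ℂ} {M : ℕ} {w : ℂ} {Z Z' : ℂ → ℂ}
    (h : IsZetaContinuation f M w Z) (h' : IsZetaContinuation f M w Z') :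
    EqOn Z Z' (zetaPoles M)ᶜ := by
  have hc : (zetaPoles M).Countable := by
    refine (countable_range (fun k : ℕ => (k : ℂ))).mono ?_
    rintro s ⟨k, -, -, rfl⟩
    exact ⟨k, rfl⟩
  have hconn : IsPreconnected (zetaPoles M)ᶜ :=
    (hc.isConnected_compl_of_one_lt_rank (by rw [Complex.rank_real_complex]; norm_num)).2
  have hmem : ((M : ℂ) + 1) ∈ (zetaPoles M)ᶜ := by
    rintro ⟨k, -, hk, hs⟩
    have : M + 1 = k := by exact_mod_cast hs
    omega
  refine h.analytic.eqOn_of_preconnected_of_eventuallyEq h'.analytic hconn hmem ?_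
  have hopen : IsOpen {s : ℂ | (M : ℝ) < s.re} := isOpen_lt continuous_const Complex.continuous_re
  filter_upwards [hopen.mem_nhds (show (M : ℂ) + 1 ∈ {s : ℂ | (M : ℝ) < s.re} by simp)] with s hs
  rw [h.eq_integral s hs, h'.eq_integral s hs]

/-- The continued generalized zeta function `s ↦ ζ_M(s, w)`, `Re w > 0`. -/
def zeta (f : ℂ → ℂ) (M : ℕ) (w : ℂ) : ℂ → ℂ :=
  Classical.epsilon (IsZetaContinuation f M w)

/-- The generalized log-gamma function `L_M(w) = ∂_s ζ_M(s, w)` at `s = 0`, for `Re w > 0`. -/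
def logGamma (f : ℂ → ℂ) (M : ℕ) (w : ℂ) : ℂ := deriv (zeta f M w) 0

/-- The operator `S_N`:
`(S_N F)(q | b) = ∑_{p=0}^N (-1)^p ∑_{1 ≤ k_1 < ⋯ < k_p ≤ N} F(q + b_0 + b_{k_1} + ⋯ + b_{k_p})`. -/
def opS (N : ℕ) (F : ℂ → ℂ) (q : ℂ) (b : ℕ → ℝ) : ℂ :=
  ∑ p ∈ Finset.range (N + 1), (-1 : ℂ) ^ p *
    ∑ K ∈ (Finset.Icc 1 N).powersetCard p, F (q + (b 0 : ℂ) + ∑ k ∈ K, (b k : ℂ))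

end RuijsenaarsGamma

end

open scoped Topology

/-! Under the integral sign, the alternating sum over subsets of `b 1, …, b N` factors as `∏ (1 -
e^{-b_k t})`. So `S_N ζ_M` at `s` is `Γ(s)⁻¹` times the Mellin transform at `s - M` of `e^{-b_0 t}
f(t) ∏ (1 - e^{-b_k t})`. The product vanishes to order `N` at `0`, so this transform converges for
`Re s > M - N`, which includes `s = 0` because `M < N`. As `1/Γ(s) = s + O(s²)`, the derivative at
`0` is the Mellin transform at `-M`, an integral of a positive function (`opS_logGamma_eq_mellin`,
`mellin_pos_of_pos`). The individual `ζ_M(s, w)` must first be continued to `s = 0`; this is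
`MellinAdmissible.exists_entire`. -/

namespace RuijsenaarsGamma

/-! ### Mellin transforms of exponentially decaying functions -/

/-- Functions analytic at `0`, continuous on the positive half-line, with exponential decay. -/
structure MellinAdmissible (h : ℂ → ℂ) : Prop where
  analytic_zero : AnalyticAt ℂ h 0
  continuousOn : ContinuousOn (fun t : ℝ => h t) (Ioi 0)
  decay : ∃ a : ℝ, 0 < a ∧ (fun t : ℝ => h t) =O[atTop] fun t => Real.exp (-a * t)

theorem MellinAdmissible.locallyIntegrableOn {h : ℂ → ℂ} (hh : MellinAdmissible h) :
    LocallyIntegrableOn (fun t : ℝ => h t) (Ioi 0) :=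
  hh.continuousOn.locallyIntegrableOn measurableSet_Ioi

theorem MellinAdmissible.isBigO_zero {h : ℂ → ℂ} (hh : MellinAdmissible h) :
    (fun t : ℝ => h t) =O[𝓝[>] 0] fun t : ℝ => t ^ (-(0 : ℝ)) := by
  have hc : ContinuousAt (fun t : ℝ => h t) 0 := by
    have : ContinuousAt h ((0 : ℝ) : ℂ) := by simpa using hh.analytic_zero.continuousAt
    exact this.comp Complex.continuous_ofReal.continuousAt
  simpa using (hc.tendsto.mono_left nhdsWithin_le_nhds).isBigO_one ℝ

theorem MellinAdmissible.mellinConvergent {h : ℂ → ℂ} (hh : MellinAdmissible h) {u : ℂ}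
    (hu : 0 < u.re) : MellinConvergent (fun t : ℝ => h t) u := by
  obtain ⟨a, ha, hd⟩ := hh.decay
  exact mellinConvergent_of_isBigO_rpow_exp ha hh.locallyIntegrableOn hd hh.isBigO_zero hu

theorem MellinAdmissible.mellin_differentiableAt {h : ℂ → ℂ} (hh : MellinAdmissible h) {u : ℂ}
    (hu : 0 < u.re) : DifferentiableAt ℂ (mellin fun t : ℝ => h t) u := by
  obtain ⟨a, ha, hd⟩ := hh.decay
  exact mellin_differentiableAt_of_isBigO_rpow_exp ha hh.locallyIntegrableOn hd hh.isBigO_zero hu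

theorem isBigO_exp_neg_mul_of_le {a b : ℝ} (hab : a ≤ b) :
    (fun t : ℝ => Real.exp (-b * t)) =O[atTop] fun t => Real.exp (-a * t) := by
  refine IsBigO.of_bound 1 ?_
  filter_upwards [eventually_ge_atTop 0] with t ht
  rw [Real.norm_of_nonneg (Real.exp_pos _).le, Real.norm_of_nonneg (Real.exp_pos _).le, one_mul,
    Real.exp_le_exp]
  nlinarith

theorem mellinAdmissible_exp_neg : MellinAdmissible fun z => exp (-z) where
  analytic_zero := by fun_prop
  continuousOn := by fun_prop
  decay := ⟨1, one_pos, IsBigO.of_bound 1 (Eventually.of_forall fun t => by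
    rw [norm_exp, Real.norm_of_nonneg (Real.exp_pos _).le]; simp)⟩

theorem MellinAdmissible.sub_const_mul {h k : ℂ → ℂ} (hh : MellinAdmissible h)
    (hk : MellinAdmissible k) (c : ℂ) : MellinAdmissible fun z => h z - c * k z where
  analytic_zero := hh.analytic_zero.fun_sub (analyticAt_const.fun_mul hk.analytic_zero)
  continuousOn := hh.continuousOn.sub (continuousOn_const.mul hk.continuousOn)
  decay := by
    obtain ⟨a, ha, hda⟩ := hh.decay
    obtain ⟨b, hb, hdb⟩ := hk.decay
    exact ⟨min a b, lt_min ha hb, (hda.trans (isBigO_exp_neg_mul_of_le (min_le_left a b))).sub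
      ((hdb.trans (isBigO_exp_neg_mul_of_le (min_le_right a b))).const_mul_left c)⟩

theorem MellinAdmissible.dslope {h : ℂ → ℂ} (hh : MellinAdmissible h) (h0 : h 0 = 0) :
    MellinAdmissible (dslope h 0) := by
  have key : ∀ t : ℝ, 0 < t → _root_.dslope h 0 (t : ℂ) = (t : ℂ)⁻¹ * h t := by
    intro t ht
    rw [dslope_of_ne _ (by exact_mod_cast ht.ne'), slope_def_field, h0]
    simp [div_eq_inv_mul]
  refine ⟨?_, ?_, ?_⟩
  · obtain ⟨p, hp⟩ := hh.analytic_zero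
    exact ⟨_, hp.has_fpower_series_dslope_fslope⟩
  · refine ContinuousOn.congr (f := fun t : ℝ => (t : ℂ)⁻¹ * h t) ?_ fun t ht => key t ht
    refine ContinuousOn.mul (ContinuousOn.inv₀ (by fun_prop) fun t ht => ?_) hh.continuousOn
    exact_mod_cast (ne_of_gt ht)
  · obtain ⟨a, ha, hd⟩ := hh.decay
    refine ⟨a, ha, IsBigO.trans (IsBigO.of_bound 1 ?_) hd⟩
    filter_upwards [eventually_ge_atTop 1] with t ht
    rw [key t (by linarith), norm_mul, norm_inv, norm_real, Real.norm_of_nonneg (by linarith)]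
    exact mul_le_mul_of_nonneg_right (inv_le_one_of_one_le₀ ht) (norm_nonneg _)

/-! ### Entire continuation of the Mellin transform over Gamma -/

theorem mellin_exp_neg {u : ℂ} (hu : 0 < u.re) :
    mellin (fun t : ℝ => exp (-(t : ℂ))) u = Gamma u := by
  rw [Gamma_eq_integral hu, GammaIntegral_eq_mellin]
  simp

/-- Splitting off the value at `0` of the integrand from a Mellin transform. -/
theorem MellinAdmissible.mellin_eq_add {h : ℂ → ℂ} (hh : MellinAdmissible h) {u : ℂ}
    (hu : 0 < u.re) :
    mellin (fun t : ℝ => h t) u = h 0 * Gamma u +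
      mellin (fun t : ℝ => _root_.dslope (fun z => h z - h 0 * exp (-z)) 0 t) (u + 1) := by
  rw [← mellin_exp_neg hu, ← mellin_cpow_smul, ← smul_eq_mul, ← mellin_const_smul]
  have h1 := hasMellin_sub (hh.mellinConvergent hu)
    ((mellinAdmissible_exp_neg.mellinConvergent hu).const_smul (h 0))
  rw [← sub_eq_iff_eq_add', ← h1.2]
  refine setIntegral_congr_fun measurableSet_Ioi fun t ht => ?_
  have ht' : (t : ℂ) ≠ 0 := by exact_mod_cast (ne_of_gt ht)
  simp only [smul_eq_mul, cpow_one]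
  rw [dslope_of_ne _ ht', slope_def_field]
  simp only [neg_zero, exp_zero, mul_one, sub_self, sub_zero]
  rw [mul_div_cancel₀ _ ht']

/-- Since `1/Γ(u) = u/Γ(u+1)`, splitting off `h 0 * exp (-z)` turns a continuation `E` for the
divided remainder into `h 0 + u * E (u + 1)` for `h`, gaining a strip of width one at each step. -/
theorem MellinAdmissible.exists_continuation_halfPlane (K : ℕ) :
    ∀ {h : ℂ → ℂ}, MellinAdmissible h → ∃ E : ℂ → ℂ,
      (∀ u : ℂ, -(K : ℝ) < u.re → DifferentiableAt ℂ E u) ∧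
      ∀ u : ℂ, 0 < u.re → E u = (Gamma u)⁻¹ * mellin (fun t : ℝ => h t) u := by
  induction K with
  | zero =>
    intro h hh
    refine ⟨fun u => (Gamma u)⁻¹ * mellin (fun t : ℝ => h t) u, fun u hu => ?_, fun u _ => rfl⟩
    exact (differentiable_one_div_Gamma u).mul (hh.mellin_differentiableAt (by simpa using hu))
  | succ K ih =>
    intro h hh
    obtain ⟨E, hE, hEq⟩ := ih ((hh.sub_const_mul mellinAdmissible_exp_neg (h 0)).dslope (by simp))
    refine ⟨fun u => h 0 + u * E (u + 1), fun u hu => ?_, fun u hu => ?_⟩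
    · have : DifferentiableAt ℂ E (u + 1) := hE _ (by push_cast at hu; simp; linarith)
      exact (differentiableAt_const _).add
        (differentiableAt_id.mul (this.comp u (differentiableAt_id.add_const 1)))
    · have hG : Gamma u ≠ 0 := Gamma_ne_zero_of_re_pos hu
      beta_reduce
      rw [hh.mellin_eq_add hu, hEq _ (by simp; linarith), mul_add, mul_comm (h 0),
        inv_mul_cancel_left₀ hG, one_div_Gamma_eq_self_mul_one_div_Gamma_add_one u, mul_assoc]

/-- Analytic functions on right half-planes that agree further to the right are equal. -/
theorem eq_of_eq_of_re_pos {F G : ℂ → ℂ} {r : ℝ} (hr : r ≤ 0)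
    (hF : ∀ u : ℂ, r < u.re → DifferentiableAt ℂ F u)
    (hG : ∀ u : ℂ, r < u.re → DifferentiableAt ℂ G u)
    (hFG : ∀ u : ℂ, 0 < u.re → F u = G u) {u : ℂ} (hu : r < u.re) : F u = G u := by
  have ho (x : ℝ) : IsOpen {s : ℂ | x < s.re} := isOpen_lt continuous_const continuous_re
  have hFa : AnalyticOnNhd ℂ F {s : ℂ | r < s.re} :=
    DifferentiableOn.analyticOnNhd (fun s hs => (hF s hs).differentiableWithinAt) (ho r)
  have hGa : AnalyticOnNhd ℂ G {s : ℂ | r < s.re} :=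
    DifferentiableOn.analyticOnNhd (fun s hs => (hG s hs).differentiableWithinAt) (ho r)
  refine hFa.eqOn_of_preconnected_of_eventuallyEq hGa (convex_halfSpace_re_gt r).isPreconnected
    (z₀ := 1) (by simp; linarith) ?_ hu
  filter_upwards [(ho 0).mem_nhds (show (0 : ℝ) < (1 : ℂ).re by simp)] with s hs using hFG s hs

/-- The Mellin transform divided by the Gamma function extends to an entire function. -/
theorem MellinAdmissible.exists_entire {h : ℂ → ℂ} (hh : MellinAdmissible h) :
    ∃ E : ℂ → ℂ, Differentiable ℂ E ∧
      ∀ u : ℂ, 0 < u.re → E u = (Gamma u)⁻¹ * mellin (fun t : ℝ => h t) u := by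
  choose E hE hEq using fun K : ℕ => exists_continuation_halfPlane K hh
  have hcons : ∀ {K L : ℕ}, K ≤ L → ∀ u : ℂ, -(K : ℝ) < u.re → E L u = E K u := by
    intro K L hKL u hu
    have hKL' : (K : ℝ) ≤ L := by exact_mod_cast hKL
    exact eq_of_eq_of_re_pos (by simp) (fun v hv => hE L v (by linarith)) (hE K)
      (fun v hv => (hEq L v hv).trans (hEq K v hv).symm) hu
  have hceil (u : ℂ) : -((⌈-u.re⌉₊ + 1 : ℕ) : ℝ) < u.re := by
    have := Nat.le_ceil (-u.re); push_cast; linarith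
  have hglue : ∀ (K : ℕ) (u : ℂ), -(K : ℝ) < u.re → E (⌈-u.re⌉₊ + 1) u = E K u := by
    intro K u hu
    rcases le_total K (⌈-u.re⌉₊ + 1) with hle | hle
    · exact hcons hle u hu
    · exact (hcons hle u (hceil u)).symm
  -- Glue: at `u` use an index whose half-plane contains `u`; consistency makes the choice
  -- immaterial.
  refine ⟨fun u => E (⌈-u.re⌉₊ + 1) u, fun u => ?_, fun u hu => hEq _ u hu⟩
  refine (hE _ u (hceil u)).congr_of_eventuallyEq ?_
  filter_upwards [(isOpen_lt continuous_const continuous_re).mem_nhds (hceil u)] with v hv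
  exact hglue _ v hv

/-! ### Continuation of the zeta function -/

theorem RuijsenaarsClass.mellinAdmissible {f : ℂ → ℂ} (hf : RuijsenaarsClass f) {w : ℂ}
    (hw : 0 < w.re) : MellinAdmissible fun z => exp (-w * z) * f z where
  analytic_zero := AnalyticAt.fun_mul (by fun_prop) hf.analytic_zero
  continuousOn := by
    refine ContinuousOn.mul (by fun_prop) fun t ht => ContinuousAt.continuousWithinAt ?_
    exact ContinuousAt.comp (f := fun t : ℝ => (t : ℂ)) (g := f)
      (hf.analytic_right t (by simpa using ht)).continuousAt continuous_ofReal.continuousAt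
  decay := by
    obtain ⟨n, hn⟩ := hf.growth
    -- Half of the exponential decay absorbs the polynomial growth of `f`.
    refine ⟨w.re / 2, by linarith, ?_⟩
    have h1 : (fun t : ℝ => exp (-w * t)) =O[atTop] fun t => Real.exp (-w.re * t) :=
      IsBigO.of_bound 1 (Eventually.of_forall fun t => by
        rw [norm_exp, Real.norm_of_nonneg (Real.exp_pos _).le]; simp)
    refine (h1.mul (hn.trans (isLittleO_pow_exp_pos_mul_atTop n (half_pos hw)).isBigO)).congr_right
      fun t => ?_
    rw [← Real.exp_add]; ring_nf

/-- The zeros `1, …, M` of this product are the possible poles of `ζ_M`. -/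
theorem inv_Gamma_sub_natCast (M : ℕ) (s : ℂ) :
    (Gamma (s - M))⁻¹ = (∏ j ∈ Finset.range M, (s - (j + 1))) * (Gamma s)⁻¹ := by
  induction M with
  | zero => simp
  | succ M ih =>
    rw [one_div_Gamma_eq_self_mul_one_div_Gamma_add_one, Finset.prod_range_succ]
    have : s - ((M + 1 : ℕ) : ℂ) + 1 = s - M := by push_cast; ring
    rw [this, ih]; push_cast; ring

theorem prod_sub_ne_zero {M : ℕ} {s : ℂ} (hs : s ∈ (zetaPoles M)ᶜ) :
    ∏ j ∈ Finset.range M, (s - (j + 1)) ≠ 0 := by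
  refine Finset.prod_ne_zero_iff.2 fun j hj h0 => hs ⟨j + 1, by omega, ?_, ?_⟩
  · have := Finset.mem_range.1 hj; omega
  · push_cast; exact sub_eq_zero.1 h0

theorem zetaPoles_finite (M : ℕ) : (zetaPoles M).Finite := by
  refine ((Set.finite_Icc 1 M).image fun k : ℕ => (k : ℂ)).subset ?_
  rintro s ⟨k, h1, h2, rfl⟩
  exact ⟨k, ⟨h1, h2⟩, rfl⟩

theorem zero_mem_compl_zetaPoles (M : ℕ) : (0 : ℂ) ∈ (zetaPoles M)ᶜ := by
  rintro ⟨k, h1, -, h⟩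
  have : k = 0 := by exact_mod_cast h.symm
  omega

theorem zetaIntegral_eq_mellin (f : ℂ → ℂ) (M : ℕ) (w s : ℂ) :
    zetaIntegral f M w s =
      (Gamma s)⁻¹ * mellin (fun t : ℝ => exp (-w * t) * f t) (s - M) := by
  rw [zetaIntegral, one_div, mellin]
  congr 1
  refine setIntegral_congr_fun measurableSet_Ioi fun t ht => ?_
  have ht' : (t : ℂ) ≠ 0 := by exact_mod_cast (ne_of_gt ht)
  simp only [smul_eq_mul]
  rw [show s - M - 1 = s - 1 - M by ring, cpow_sub (s - 1) _ ht', cpow_natCast]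
  ring

theorem isZetaContinuation_of_entire {f E : ℂ → ℂ} {w : ℂ} (M : ℕ) (hE : Differentiable ℂ E)
    (hEq : ∀ u : ℂ, 0 < u.re →
      E u = (Gamma u)⁻¹ * mellin (fun t : ℝ => exp (-w * t) * f t) u) :
    IsZetaContinuation f M w fun s => E (s - M) / ∏ j ∈ Finset.range M, (s - (j + 1)) where
  analytic := by
    refine DifferentiableOn.analyticOnNhd (fun s hs => ?_)
      (zetaPoles_finite M).isClosed.isOpen_compl
    refine DifferentiableAt.differentiableWithinAt (DifferentiableAt.div ?_ ?_ (prod_sub_ne_zero hs))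
    · exact (hE (s - M)).comp s (differentiableAt_id.sub_const _)
    · fun_prop
  eq_integral s hs := by
    have hp : s ∈ (zetaPoles M)ᶜ := by
      rintro ⟨k, -, hk, rfl⟩
      have : M < k := by exact_mod_cast hs
      omega
    rw [hEq _ (by simpa using hs), zetaIntegral_eq_mellin, inv_Gamma_sub_natCast, mul_assoc,
      mul_div_cancel_left₀ _ (prod_sub_ne_zero hp)]

/-- Exhibiting one continuation makes the choice in `zeta` meaningful; uniqueness then identifies
the two. -/
theorem IsZetaContinuation.zeta_eqOn {f : ℂ → ℂ} {M : ℕ} {w : ℂ} {Z : ℂ → ℂ}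
    (h : IsZetaContinuation f M w Z) : EqOn (zeta f M w) Z (zetaPoles M)ᶜ :=
  IsZetaContinuation.eqOn (Classical.epsilon_spec ⟨Z, h⟩) h

/-! ### The alternating sum as a single Mellin transform -/

/-- The function whose Mellin transform gives `S_N L_M`. -/
noncomputable def opSIntegrand (f : ℂ → ℂ) (N : ℕ) (b : ℕ → ℝ) (z : ℂ) : ℂ :=
  exp (-(b 0 : ℂ) * z) * f z * ∏ k ∈ Finset.Icc 1 N, (1 - exp (-(b k : ℂ) * z))

theorem opS_eq_sum_powerset (N : ℕ) (F : ℂ → ℂ) (q : ℂ) (b : ℕ → ℝ) :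
    opS N F q b = ∑ K ∈ (Finset.Icc 1 N).powerset,
      (-1 : ℂ) ^ K.card * F (q + (b 0 : ℂ) + ∑ k ∈ K, (b k : ℂ)) := by
  rw [opS, Finset.sum_powerset, Nat.card_Icc, Nat.add_sub_cancel]
  refine Finset.sum_congr rfl fun p _ => ?_
  rw [Finset.mul_sum]
  refine Finset.sum_congr rfl fun K hK => ?_
  rw [(Finset.mem_powersetCard.1 hK).2]

theorem opSIntegrand_eq_sum (f : ℂ → ℂ) (N : ℕ) (b : ℕ → ℝ) (z : ℂ) :
    opSIntegrand f N b z = ∑ K ∈ (Finset.Icc 1 N).powerset,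
      (-1 : ℂ) ^ K.card * (exp (-((0 : ℂ) + (b 0 : ℂ) + ∑ k ∈ K, (b k : ℂ)) * z) * f z) := by
  rw [opSIntegrand]
  simp_rw [sub_eq_add_neg (1 : ℂ), add_comm (1 : ℂ)]
  rw [Finset.prod_add, Finset.mul_sum]
  refine Finset.sum_congr rfl fun K _ => ?_
  rw [Finset.prod_const_one, mul_one, Finset.prod_neg, ← exp_sum, zero_add, neg_add, add_mul,
    exp_add, ← Finset.sum_mul, Finset.sum_neg_distrib]
  ring

theorem re_add_sum_pos {N : ℕ} {b : ℕ → ℝ} (hb : ∀ k : ℕ, k ≤ N → 0 < b k) {K : Finset ℕ}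
    (hK : K ∈ (Finset.Icc 1 N).powerset) :
    0 < ((0 : ℂ) + (b 0 : ℂ) + ∑ k ∈ K, (b k : ℂ)).re := by
  have h0 := hb 0 (Nat.zero_le N)
  have h1 : 0 ≤ ∑ k ∈ K, b k := Finset.sum_nonneg fun k hk =>
    (hb k (Finset.mem_Icc.1 (Finset.mem_powerset.1 hK hk)).2).le
  rw [← ofReal_sum, zero_add, ← ofReal_add, ofReal_re]
  linarith

section Integrand

variable {f : ℂ → ℂ} {N : ℕ} {b : ℕ → ℝ}

theorem mellin_opSIntegrand (hf : RuijsenaarsClass f) (hb : ∀ k : ℕ, k ≤ N → 0 < b k) {u : ℂ}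
    (hu : 0 < u.re) :
    mellin (fun t : ℝ => opSIntegrand f N b t) u = ∑ K ∈ (Finset.Icc 1 N).powerset,
      (-1 : ℂ) ^ K.card *
        mellin (fun t : ℝ => exp (-((0 : ℂ) + (b 0 : ℂ) + ∑ k ∈ K, (b k : ℂ)) * t) * f t) u := by
  simp_rw [opSIntegrand_eq_sum, ← smul_eq_mul ((-1 : ℂ) ^ _), ← mellin_const_smul]
  simp only [mellin, Finset.smul_sum]
  refine integral_finsetSum _ fun K hK => ?_
  exact ((hf.mellinAdmissible (re_add_sum_pos hb hK)).mellinConvergent hu).const_smul _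

theorem mellinAdmissible_opSIntegrand (hf : RuijsenaarsClass f)
    (hb : ∀ k : ℕ, k ≤ N → 0 < b k) : MellinAdmissible (opSIntegrand f N b) := by
  have h0 : 0 < ((b 0 : ℝ) : ℂ).re := by simpa using hb 0 (Nat.zero_le N)
  have hg := hf.mellinAdmissible h0
  refine ⟨hg.analytic_zero.fun_mul (by fun_prop), hg.continuousOn.mul (by fun_prop), ?_⟩
  obtain ⟨a, ha, hd⟩ := hg.decay
  have h1 : (fun t : ℝ => ∏ k ∈ Finset.Icc 1 N, (1 - exp (-(b k : ℂ) * t))) =O[atTop]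
      fun _ => (1 : ℝ) := by
    have : ∀ k ∈ Finset.Icc 1 N, (fun t : ℝ => 1 - exp (-(b k : ℂ) * t)) =O[atTop]
        fun _ => (1 : ℝ) := by
      intro k hk
      refine IsBigO.of_bound 2 ?_
      filter_upwards [eventually_ge_atTop 0] with t ht
      have hk' := hb k (Finset.mem_Icc.1 hk).2
      have he : ‖exp (-(b k : ℂ) * t)‖ ≤ 1 := by
        rw [norm_exp, Real.exp_le_one_iff]
        simpa using mul_nonneg hk'.le ht
      calc _ ≤ ‖(1 : ℂ)‖ + ‖exp (-(b k : ℂ) * t)‖ := norm_sub_le _ _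
        _ ≤ 2 * ‖(1 : ℝ)‖ := by rw [norm_one, norm_one]; linarith
    simpa using IsBigO.finsetProd this
  exact ⟨a, ha, (hd.mul h1).congr_right fun t => mul_one _⟩

/-- Each of the `N` factors has a zero at the origin; this moves the abscissa of convergence from
`0` to `-N`. -/
theorem isBigO_opSIntegrand (hf : RuijsenaarsClass f) :
    (fun t : ℝ => opSIntegrand f N b t) =O[𝓝[>] 0] fun t : ℝ => t ^ (-(-(N : ℝ))) := by
  have hc : ContinuousAt (fun z => exp (-(b 0 : ℂ) * z) * f z) 0 :=
    ContinuousAt.mul (by fun_prop) hf.analytic_zero.continuousAt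
  have hp : (∏ k ∈ Finset.Icc 1 N, fun z : ℂ => 1 - exp (-(b k : ℂ) * z)) =O[𝓝 0]
      fun z : ℂ => z ^ N := by
    have : ∀ k ∈ Finset.Icc 1 N, (fun z : ℂ => 1 - exp (-(b k : ℂ) * z)) =O[𝓝 0]
        fun z : ℂ => z := by
      intro k _
      have hd : DifferentiableAt ℂ (fun z : ℂ => 1 - exp (-(b k : ℂ) * z)) 0 := by fun_prop
      simpa using hd.isBigO_sub
    have := IsBigO.finsetProd this
    simp only [Finset.prod_const, Nat.card_Icc, Nat.add_sub_cancel] at this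
    rw [Finset.prod_fn]
    exact this
  have h := ((hc.tendsto.isBigO_one ℂ).mul hp).comp_tendsto
    (show Tendsto (fun t : ℝ => (t : ℂ)) (𝓝[>] 0) (𝓝 0) from
      (continuous_ofReal.tendsto' 0 0 (by simp)).mono_left nhdsWithin_le_nhds)
  refine (h.congr_left fun t => ?_).trans (IsBigO.of_bound 1 (Eventually.of_forall fun t => ?_))
  · simp [opSIntegrand, Finset.prod_apply]
  · simp

theorem mellinConvergent_opSIntegrand (hf : RuijsenaarsClass f)
    (hb : ∀ k : ℕ, k ≤ N → 0 < b k) {u : ℂ} (hu : -(N : ℝ) < u.re) :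
    MellinConvergent (fun t : ℝ => opSIntegrand f N b t) u := by
  have h := mellinAdmissible_opSIntegrand hf hb
  obtain ⟨a, ha, hd⟩ := h.decay
  exact mellinConvergent_of_isBigO_rpow_exp ha h.locallyIntegrableOn hd (isBigO_opSIntegrand hf) hu

theorem mellin_opSIntegrand_differentiableAt (hf : RuijsenaarsClass f)
    (hb : ∀ k : ℕ, k ≤ N → 0 < b k) {u : ℂ} (hu : -(N : ℝ) < u.re) :
    DifferentiableAt ℂ (mellin fun t : ℝ => opSIntegrand f N b t) u := by
  have h := mellinAdmissible_opSIntegrand hf hb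
  obtain ⟨a, ha, hd⟩ := h.decay
  exact mellin_differentiableAt_of_isBigO_rpow_exp ha h.locallyIntegrableOn hd
    (isBigO_opSIntegrand hf) hu

/-- `1/Γ` has a simple zero at `0` with derivative `1`. -/
theorem deriv_inv_Gamma_mul {F : ℂ → ℂ} (hF : DifferentiableAt ℂ F 0) :
    deriv (fun s => (Gamma s)⁻¹ * F s) 0 = F 0 := by
  have h1 : (fun s => (Gamma s)⁻¹ * F s) = fun s => s * ((Gamma (s + 1))⁻¹ * F s) := by
    funext s
    rw [one_div_Gamma_eq_self_mul_one_div_Gamma_add_one, mul_assoc]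
  have hG : DifferentiableAt ℂ (fun s : ℂ => (Gamma (s + 1))⁻¹ * F s) 0 :=
    ((differentiable_one_div_Gamma.comp (differentiable_id.add_const 1)) 0).mul hF
  rw [h1, ((hasDerivAt_id' (0 : ℂ)).fun_mul hG.hasDerivAt).deriv]
  simp

theorem opS_logGamma_eq_mellin (hf : RuijsenaarsClass f) {M : ℕ} (hMN : M < N)
    (hb : ∀ k : ℕ, k ≤ N → 0 < b k) :
    opS N (logGamma f M) 0 b = mellin (fun t : ℝ => opSIntegrand f N b t) (-(M : ℂ)) := by
  set w : Finset ℕ → ℂ := fun K => 0 + (b 0 : ℂ) + ∑ k ∈ K, (b k : ℂ) with hw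
  have hex : ∀ K : Finset ℕ, ∃ E : ℂ → ℂ, K ∈ (Finset.Icc 1 N).powerset →
      Differentiable ℂ E ∧ ∀ u : ℂ, 0 < u.re →
        E u = (Gamma u)⁻¹ * mellin (fun t : ℝ => exp (-(w K) * t) * f t) u := by
    intro K
    by_cases hK : K ∈ (Finset.Icc 1 N).powerset
    · obtain ⟨E, hE⟩ := (hf.mellinAdmissible (re_add_sum_pos hb hK)).exists_entire
      exact ⟨E, fun _ => hE⟩
    · exact ⟨0, fun h => absurd h hK⟩
  choose E hE using hex
  -- For `Re u > 0` this is linearity of the integral; the identity theorem carries it to `Re u >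
  -- -N`.
  have hsum : ∀ u : ℂ, -(N : ℝ) < u.re →
      ∑ K ∈ (Finset.Icc 1 N).powerset, (-1 : ℂ) ^ K.card * E K u =
        (Gamma u)⁻¹ * mellin (fun t : ℝ => opSIntegrand f N b t) u := by
    intro u hu
    refine eq_of_eq_of_re_pos
      (F := fun u => ∑ K ∈ (Finset.Icc 1 N).powerset, (-1 : ℂ) ^ K.card * E K u)
      (G := fun u => (Gamma u)⁻¹ * mellin (fun t : ℝ => opSIntegrand f N b t) u)
      (r := -(N : ℝ)) (by simp) (fun v _ => ?_) (fun v hv => ?_) (fun v hv => ?_) hu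
    · exact DifferentiableAt.fun_sum fun K hK => ((hE K hK).1 v).const_mul _
    · exact (differentiable_one_div_Gamma v).mul (mellin_opSIntegrand_differentiableAt hf hb hv)
    · rw [mellin_opSIntegrand hf hb hv, Finset.mul_sum]
      refine Finset.sum_congr rfl fun K hK => ?_
      rw [(hE K hK).2 v hv]
      ring
  have hz := fun K hK => isZetaContinuation_of_entire M (hE K hK).1 (hE K hK).2
  have hopen := (zetaPoles_finite M).isClosed.isOpen_compl.mem_nhds (zero_mem_compl_zetaPoles M)
  have hdz : ∀ K ∈ (Finset.Icc 1 N).powerset, DifferentiableAt ℂ (zeta f M (w K)) 0 := by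
    intro K hK
    refine ((hz K hK).analytic 0 (zero_mem_compl_zetaPoles M)).differentiableAt.congr_of_eventuallyEq
      ?_
    exact eventually_of_mem hopen (hz K hK).zeta_eqOn
  have hd : opS N (logGamma f M) 0 b =
      deriv (fun s => ∑ K ∈ (Finset.Icc 1 N).powerset, (-1 : ℂ) ^ K.card * zeta f M (w K) s) 0 := by
    rw [opS_eq_sum_powerset, deriv_fun_sum fun K hK => (hdz K hK).const_mul _]
    refine Finset.sum_congr rfl fun K hK => ?_
    rw [deriv_const_mul _ (hdz K hK)]
    rfl
  have hMN' : (M : ℝ) < N := by exact_mod_cast hMN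
  have hloc : (fun s => ∑ K ∈ (Finset.Icc 1 N).powerset, (-1 : ℂ) ^ K.card * zeta f M (w K) s)
      =ᶠ[𝓝 0] fun s => (Gamma s)⁻¹ * mellin (fun t : ℝ => opSIntegrand f N b t) (s - M) := by
    -- `M < N` makes this half-plane a neighbourhood of `0`.
    have hre : {s : ℂ | (M : ℝ) - N < s.re} ∈ 𝓝 (0 : ℂ) :=
      (isOpen_lt continuous_const continuous_re).mem_nhds (by simpa using hMN)
    filter_upwards [hopen, hre] with s hs hs'
    have hs'' : -(N : ℝ) < (s - M).re := by
      have : (M : ℝ) - N < s.re := hs'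
      simp; linarith
    calc _ = (∑ K ∈ (Finset.Icc 1 N).powerset, (-1 : ℂ) ^ K.card * E K (s - M)) /
          ∏ j ∈ Finset.range M, (s - (j + 1)) := by
          rw [Finset.sum_div]
          refine Finset.sum_congr rfl fun K hK => ?_
          rw [(hz K hK).zeta_eqOn hs, mul_div_assoc]
      _ = _ := by
          rw [hsum _ hs'', inv_Gamma_sub_natCast, mul_assoc,
            mul_div_cancel_left₀ _ (prod_sub_ne_zero hs)]
  have hF : DifferentiableAt ℂ (fun s : ℂ => mellin (fun t : ℝ => opSIntegrand f N b t) (s - M))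
      0 :=
    (mellin_opSIntegrand_differentiableAt hf hb (by simpa using hMN)).comp (0 : ℂ)
      (differentiableAt_id.sub_const (M : ℂ))
  rw [hd, hloc.deriv_eq, deriv_inv_Gamma_mul hF, zero_sub]

/-! ### Positivity -/

theorem opSIntegrand_pos (hpos : ∀ t : ℝ, 0 ≤ t → 0 < (f (t : ℂ)).re ∧ (f (t : ℂ)).im = 0)
    (hb : ∀ k : ℕ, k ≤ N → 0 < b k) {t : ℝ} (ht : 0 < t) :
    ∃ r : ℝ, 0 < r ∧ opSIntegrand f N b t = r := by
  obtain ⟨h1, h2⟩ := hpos t ht.le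
  refine ⟨Real.exp (-b 0 * t) * (f t).re * ∏ k ∈ Finset.Icc 1 N, (1 - Real.exp (-b k * t)),
    mul_pos (mul_pos (Real.exp_pos _) h1) (Finset.prod_pos fun k hk => ?_), ?_⟩
  · have := mul_pos (hb k (Finset.mem_Icc.1 hk).2) ht
    rw [sub_pos, Real.exp_lt_one_iff]
    linarith
  · have h3 : f t = ((f t).re : ℂ) := Complex.ext (by simp) (by simp [h2])
    rw [opSIntegrand]
    conv_lhs => rw [h3]
    push_cast
    rfl

theorem mellin_pos_of_pos {g : ℝ → ℂ} {x : ℝ} (hg : ∀ t : ℝ, 0 < t → ∃ r : ℝ, 0 < r ∧ g t = r)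
    (hc : MellinConvergent g x) : 0 < (mellin g x).re ∧ (mellin g x).im = 0 := by
  have key : ∀ t : ℝ, 0 < t → ∃ r : ℝ, 0 < r ∧ (t : ℂ) ^ ((x : ℂ) - 1) • g t = r := by
    intro t ht
    obtain ⟨r, hr, he⟩ := hg t ht
    refine ⟨t ^ (x - 1) * r, mul_pos (Real.rpow_pos_of_pos ht _) hr, ?_⟩
    rw [he, smul_eq_mul, ofReal_mul, ofReal_cpow ht.le]
    push_cast
    rfl
  have hre : (mellin g x).re = ∫ t in Ioi (0 : ℝ), ((t : ℂ) ^ ((x : ℂ) - 1) • g t).re :=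
    (integral_re hc).symm
  have him : (mellin g x).im = ∫ t in Ioi (0 : ℝ), ((t : ℂ) ^ ((x : ℂ) - 1) • g t).im :=
    (integral_im hc).symm
  have hrpos : ∀ t ∈ Ioi (0 : ℝ), 0 < ((t : ℂ) ^ ((x : ℂ) - 1) • g t).re := by
    intro t ht
    obtain ⟨r, hr, he⟩ := key t ht
    rw [he]; simpa using hr
  constructor
  · have hi : IntegrableOn (fun t : ℝ => ((t : ℂ) ^ ((x : ℂ) - 1) • g t).re) (Ioi 0) := hc.re
    -- Strict positivity: the support contains all of `(0, ∞)`, a set of positive measure.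
    rw [hre, setIntegral_pos_iff_support_of_nonneg_ae _ hi]
    · have : Ioi (0 : ℝ) ⊆
          Function.support fun t : ℝ => ((t : ℂ) ^ ((x : ℂ) - 1) • g t).re :=
        fun t ht => (hrpos t ht).ne'
      rw [inter_eq_right.2 this]
      simp
    · filter_upwards [ae_restrict_mem measurableSet_Ioi] with t ht using (hrpos t ht).le
  · rw [him]
    refine setIntegral_eq_zero_of_forall_eq_zero fun t ht => ?_
    obtain ⟨r, hr, he⟩ := key t ht
    rw [he]; simp

end Integrand

end RuijsenaarsGamma

theorem mainTheorem4 (f : ℂ → ℂ) (hf : RuijsenaarsGamma.RuijsenaarsClass f)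
    (hpos : ∀ t : ℝ, 0 ≤ t → 0 < (f (t : ℂ)).re ∧ (f (t : ℂ)).im = 0)
    (M N : ℕ) (hMN : M < N) (b : ℕ → ℝ) (hb : ∀ k : ℕ, k ≤ N → 0 < b k) :
    0 < (RuijsenaarsGamma.opS N (RuijsenaarsGamma.logGamma f M) 0 b).re ∧
      (RuijsenaarsGamma.opS N (RuijsenaarsGamma.logGamma f M) 0 b).im = 0 := by
  have hx : (((-(M : ℝ)) : ℝ) : ℂ) = -(M : ℂ) := by push_cast; rfl
  rw [RuijsenaarsGamma.opS_logGamma_eq_mellin hf hMN hb, ← hx]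
  exact RuijsenaarsGamma.mellin_pos_of_pos
    (fun t ht => RuijsenaarsGamma.opSIntegrand_pos hpos hb ht)
    (RuijsenaarsGamma.mellinConvergent_opSIntegrand hf hb (by simpa using hMN))
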